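/- Setting. Let $\Theta$ (states) and $A$ (actions) be finite sets, $u(a)\in\mathbb{R}^\Theta$ the payoff vector of $a\in A$, and let $X$ be an $m$-question profile, i.e. a matrix $X(a)\in\mathbb{R}^{m\times|\Theta|}$ for each $a\in A$. A belief is a probability vector $p$ on $\Theta$, and $\mathbb{E}_p$ is the expectation under $p$. $X$ is incentivizable if there is $V:\mathbb{R}^m\times A\times\Theta\to[0,1]$ such that for every belief $p$ $$\arg\max_{(r,a)}\mathbb{E}_pV(r,a,\theta)=\{(\mathbb{E}_pX(a),a): a\in\arg\max_{a\in A}\mathbb{E}_pu(a)\}.$$ $X$ is robustly jointly incentivizable if there are invertible $\mu(a)\in\mathbb{R}^{m\times m}$, $a\in A$, such that for every $t\in\mathbb{R}^{m\times|\Theta|}$ the profile $a\mapsto X(a)+\mu(a)t$ is incentivizable. $X$ is jointly aligned with $u$ if there are a column vector $\lambda\in\mathbb{R}^m$, a matrix $d\in\mathbb{R}^{m\times|\Theta|}$ and, for each $a\in A$, an invertible $\Gamma(a)\in\mathbb{R}^{m\times m}$ and a column vector $\kappa(a)\in\mathbb{R}^m$ such that $X(a)=\Gamma(a)(\lambda u(a)+d)+\kappa(a)\mathbf{1}$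 for all $a\in A$, where $u(a)$ and the all-ones vector $\mathbf 1$ are row vectors. The adjacency graph $G$ has vertex set $A$; distinct $a,b$ are adjacent if under some belief $p$ the set of optimal actions (maximizers of $\mathbb{E}_pu$) is exactly $\{a,b\}$. $G$ is one-block if it is connected and has no cut-vertex (a vertex whose deletion leaves a disconnected graph). Write $\bar v$ for $v\in\mathbb{R}^\Theta$ minus its average over $\Theta$, and $\Delta_a^b=\bar u(b)-\bar u(a)$. Let $\mathbb{F}$ be any field (for instance $\mathbb{R}$ or $\mathbb{F}_2$). Fix an orientation of the edges of $G$. The incidence vector over $\mathbb{F}$ of a cycle $C$, traversed in one of its two directions, has entry $\pm1$ at the edges of $C$ ($+1$ where $C$ follows the orientation, $-1$ where it runs against it) and $0$ elsewhere; over $\mathbb{F}_2$ it is the $0/1$ indicator vector of $C$. A cycle basis is a set of cycles whose incidence vectors form a basis of the kernel over $\mathbb{F}$ of the vertex-edge incidence matrix of $G$; a minimum cycle basis is one of minimal total length; its members are its elementary cycles. Theorem. Suppose that no action is weakly dominated by another one (if $u(a)\le u(b)$ in every state, then $u(a)=u(b)$), that $G$ is one-block, and that 1. some minimum cycle basis of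 $G$ has all its elementary cycles of length less than $|\Theta|-(m-1)$; 2. for some minimum cycle basis of $G$, for each of its elementary cycles $C$ the family $\{\Delta_a^b:(a\to b)\in C\}$ has rank $|C|-1$. Then $X$ is robustly jointly incentivizable if and only if $X$ is jointly aligned with $u$. -/

import Mathlib

namespace BeliefElicitation

variable {A Θ : Type*} {m : ℕ}

/-! ### Tasks, question profiles and incentivizability -/

/-- The set of global maximizers of `f`. -/
def argmax {α : Type*} (f : α → ℝ) : Set α := {x | ∀ y, f y ≤ f x}

/-- Expectation of `v : Θ → ℝ` under the belief `p` (beliefs are the elements of `stdSimplex ℝ Θ`). -/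
def expect [Fintype Θ] (p v : Θ → ℝ) : ℝ := ∑ θ, p θ * v θ

/-- The actions that are optimal under the belief `p` in the task with payoffs `u a θ`. -/
def optimalActions [Fintype Θ] (u : A → Θ → ℝ) (p : Θ → ℝ) : Set A :=
  argmax fun a => expect p (u a)

/-- The `m`-question profile `X` (for each action an `m × Θ` matrix, one row per question) is
incentivizable: some elicitation method `V` with values in `[0, 1]` makes, under every belief, the
optimal pairs (report, action) exactly the truthful reports at the actions optimal in the task. -/
def Incentivizable [Fintype Θ] (u : A → Θ → ℝ) (X : A → Matrix (Fin m) Θ ℝ) : Prop :=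
  ∃ V : (Fin m → ℝ) → A → Θ → unitInterval, ∀ p ∈ stdSimplex ℝ Θ,
    argmax (fun ra : (Fin m → ℝ) × A => expect p (fun θ => (V ra.1 ra.2 θ : ℝ))) =
      {ra | ra.2 ∈ optimalActions u p ∧ ra.1 = fun j => expect p (X ra.2 j)}

/-- Robust joint incentivizability of the `m`-question profile `X`. -/
def RobustlyIncentivizable [Fintype Θ] (u : A → Θ → ℝ) (X : A → Matrix (Fin m) Θ ℝ) : Prop :=
  ∃ μ : A → Matrix (Fin m) (Fin m) ℝ, (∀ a, IsUnit (μ a)) ∧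
    ∀ t : Matrix (Fin m) Θ ℝ, Incentivizable u (fun a => X a + μ a * t)

/-- Joint alignment: `X(a) = Γ(a) (λ u(a) + d) + κ(a) 𝟏` for all `a`, with `λ` and `κ(a)` column
vectors, `u(a)` and `𝟏` row vectors, and `Γ(a)` invertible. -/
def JointlyAligned (u : A → Θ → ℝ) (X : A → Matrix (Fin m) Θ ℝ) : Prop :=
  ∃ (lam : Fin m → ℝ) (d : Matrix (Fin m) Θ ℝ) (Γ : A → Matrix (Fin m) (Fin m) ℝ)
    (κ : A → Fin m → ℝ), (∀ a, IsUnit (Γ a)) ∧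
      ∀ a, X a = Γ a * (Matrix.vecMulVec lam (u a) + d) + Matrix.vecMulVec (κ a) (fun _ => 1)

/-! ### The adjacency graph -/

/-- Two distinct actions are adjacent when, under some belief, they are exactly the optimal ones. -/
def adjacencyGraph [Fintype Θ] (u : A → Θ → ℝ) : SimpleGraph A where
  Adj a b := a ≠ b ∧ ∃ p ∈ stdSimplex ℝ Θ, optimalActions u p = {a, b}
  symm := ⟨fun a b h => ⟨h.1.symm, by simpa only [Set.pair_comm b a] using h.2⟩⟩
  loopless := ⟨fun _ h => h.1 rfl⟩

/-- `v` is a cut-vertex of `G`: deleting it leaves a disconnected graph. -/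
def IsCutVertex (G : SimpleGraph A) (v : A) : Prop :=
  ¬ (G.induce ({v}ᶜ : Set A)).Preconnected

/-- `G` consists of one block: it is connected and has no cut-vertex. -/
def OneBlock (G : SimpleGraph A) : Prop :=
  G.Connected ∧ ∀ v, ¬ IsCutVertex G v

/-! ### Cycle bases -/

/-- The cycle space of `G` over the field `𝔽`: antisymmetric functions on ordered pairs of vertices,
supported on edges, with zero net flow at each vertex. After an orientation of each edge is chosen,
such a function is determined by its values on the oriented edges, and this is the kernel of the
vertex-edge incidence matrix. For `𝔽 = ZMod 2` this is the space of even edge sets. -/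
def cycleSpace [Fintype A] (𝔽 : Type*) [Field 𝔽] (G : SimpleGraph A) :
    Submodule 𝔽 (A → A → 𝔽) where
  carrier := {f | (∀ a b, f a b = -f b a) ∧ (∀ a b, ¬ G.Adj a b → f a b = 0) ∧
    ∀ a, ∑ b, f a b = 0}
  zero_mem' := by simp
  add_mem' := by
    rintro f g ⟨hf1, hf2, hf3⟩ ⟨hg1, hg2, hg3⟩
    refine ⟨fun a b => ?_, fun a b h => ?_, fun a => ?_⟩
    · simp only [Pi.add_apply]; rw [hf1 a b, hg1 a b]; ring
    · simp [hf2 a b h, hg2 a b h]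
    · simp [Finset.sum_add_distrib, hf3 a, hg3 a]
  smul_mem' := by
    rintro c f ⟨hf1, hf2, hf3⟩
    refine ⟨fun a b => ?_, fun a b h => ?_, fun a => ?_⟩
    · simp only [Pi.smul_apply, smul_eq_mul]; rw [hf1 a b]; ring
    · simp [hf2 a b h]
    · simp [← Finset.mul_sum, hf3 a]

/-- A (simple) cycle of `G`, given by a closed walk that runs through it once. -/
structure Cycle (G : SimpleGraph A) where
  base : A
  walk : G.Walk base base
  isCycle : walk.IsCycle

/-- The cycle `C` runs through the arc `a → b`. -/
def Cycle.HasArc {G : SimpleGraph A} (C : Cycle G) (a b : A) : Prop :=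
  ∃ e ∈ C.walk.darts, e.fst = a ∧ e.snd = b

/-- The number of arcs of `C`. -/
def Cycle.length {G : SimpleGraph A} (C : Cycle G) : ℕ := C.walk.length

open Classical in
/-- The incidence vector of `C`: `1` on its arcs, `-1` on the reversed arcs and `0` elsewhere.
(Over `ZMod 2` this is the `0/1` indicator of the edges of `C`.) The starting point of the walk does
not matter, and reversing the walk changes the sign of the vector only. -/
noncomputable def Cycle.vector (𝔽 : Type*) [Field 𝔽] {G : SimpleGraph A} (C : Cycle G) :
    A → A → 𝔽 :=
  fun a b => if C.HasArc a b then 1 else if C.HasArc b a then -1 else 0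

/-- `𝒞` is a cycle basis of `G`: its incidence vectors form a basis of the cycle space. -/
def IsCycleBasis [Fintype A] (𝔽 : Type*) [Field 𝔽] (G : SimpleGraph A)
    (𝒞 : Finset (Cycle G)) : Prop :=
  LinearIndepOn 𝔽 (Cycle.vector 𝔽) (𝒞 : Set (Cycle G)) ∧
    Submodule.span 𝔽 (Cycle.vector 𝔽 '' (𝒞 : Set (Cycle G))) = cycleSpace 𝔽 G

/-- `𝒞` is a minimum cycle basis of `G`: a cycle basis of minimal total length. Its members are the
elementary cycles. -/
def IsMinCycleBasis [Fintype A] (𝔽 : Type*) [Field 𝔽] (G : SimpleGraph A)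
    (𝒞 : Finset (Cycle G)) : Prop :=
  IsCycleBasis 𝔽 G 𝒞 ∧
    ∀ 𝒟 : Finset (Cycle G), IsCycleBasis 𝔽 G 𝒟 → ∑ C ∈ 𝒞, C.length ≤ ∑ C ∈ 𝒟, C.length

/-! ### The two assumptions -/

/-- `v` minus its average over the states. -/
noncomputable def center [Fintype Θ] (v : Θ → ℝ) : Θ → ℝ :=
  fun θ => v θ - (∑ θ', v θ') / Fintype.card Θ

/-- The payoff difference vector of the pair `(a, b)`. -/
noncomputable def payoffDiff [Fintype Θ] (u : A → Θ → ℝ) (a b : A) : Θ → ℝ :=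
  center (u b) - center (u a)

/-- Some minimum cycle basis of the adjacency graph has all its cycles of length less than
`|Θ| - (m - 1)`. -/
def CycleLengthAssumption [Fintype A] [Fintype Θ] (𝔽 : Type*) [Field 𝔽] (u : A → Θ → ℝ)
    (m : ℕ) : Prop :=
  ∃ 𝒞 : Finset (Cycle (adjacencyGraph u)), IsMinCycleBasis 𝔽 (adjacencyGraph u) 𝒞 ∧
    ∀ C ∈ 𝒞, (C.length : ℤ) < (Fintype.card Θ : ℤ) - ((m : ℤ) - 1)

/-- For some minimum cycle basis of the adjacency graph, the payoff difference vectors along each of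
its cycles `C` have rank `|C| - 1`. -/
def IndependenceAssumption [Fintype A] [Fintype Θ] (𝔽 : Type*) [Field 𝔽] (u : A → Θ → ℝ) : Prop :=
  ∃ 𝒞 : Finset (Cycle (adjacencyGraph u)), IsMinCycleBasis 𝔽 (adjacencyGraph u) 𝒞 ∧
    ∀ C ∈ 𝒞, Set.finrank ℝ {v : Θ → ℝ | ∃ a b, C.HasArc a b ∧ v = payoffDiff u a b} =
      C.length - 1

/-- No action is weakly dominated by another one. -/
def NoWeaklyDominatedAction (u : A → Θ → ℝ) : Prop :=
  ∀ a b, (∀ θ, u a θ ≤ u b θ) → u a = u b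

end BeliefElicitation

/-! Sufficiency. Reports can be relabelled by an invertible affine map at each action, so only `λ
u(a) + d` has to be incentivized, and a perturbation `t` is absorbed by `d` when `μ = Γ`. Pay the
quadratic score of the report plus `K u(a)`. Truthful reports then earn `∑ (E Z_j)² + K E u`.
Between two actions the squares differ by a bounded multiple of the difference in `E u`, so a large
`K` makes this value order the actions as `E u` does (`incentivizable_vecMulVec_add`).

Necessity. With `Y = μ⁻¹ X`, the choice `t = -Y(a)` leaves no question at `a` and `μ(b) (Y(b) -
Y(a))` at `b`. On beliefs where the adjacent actions `a`, `b` tie, the optimal value is then locally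
linear, being the expectation of one fixed payoff at `a`. The payoff at `b` of the report that is
truthful at an interior tie `p` lies below that value and meets it at `p`, so the two agree along
the tie hyperplane. Uniqueness of the optimal report forces the truth at `b` to be constant there
(`Incentivizable.expect_eq_zero`). Up to constants, each row of `Y(b) - Y(a)` is therefore a
multiple `c(a,b)` of `u(b) - u(a)`.

Both kinds of differences sum to zero around an elementary cycle, and the rank condition leaves only
one linear relation, so `c` is constant on that cycle (`Cycle.coeff_eq`). In a one-block graph `c`
is then constant on all edges (`OneBlock.exists_eq_of_adj`). Its value for question `j` is `λ_j`,
and connectedness makes `Y - λ u` independent of the action up to constants. -/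

namespace BeliefElicitation

/-! ### Edge functions constant along the cycles of a cycle basis -/

section Graph

variable {A : Type*} (𝔽 : Type*) [Field 𝔽] {G : SimpleGraph A}

open Classical in
/-- The unit flow from `a` to `b` along the arc `a → b`. -/
noncomputable def arcFlow (a b : A) : A → A → 𝔽 :=
  fun x y => (if x = a ∧ y = b then 1 else 0) - (if x = b ∧ y = a then 1 else 0)

theorem arcFlow_antisymm (a b x y : A) : arcFlow 𝔽 a b x y = -arcFlow 𝔽 a b y x := by
  classical
  rw [arcFlow, arcFlow, neg_sub]
  exact congrArg₂ _ (if_congr and_comm rfl rfl) (if_congr and_comm rfl rfl)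

theorem arcFlow_eq_zero {a b : A} (hab : G.Adj a b) {x y : A} (hxy : ¬ G.Adj x y) :
    arcFlow 𝔽 a b x y = 0 := by
  have h₁ : ¬ (x = a ∧ y = b) := by rintro ⟨rfl, rfl⟩; exact hxy hab
  have h₂ : ¬ (x = b ∧ y = a) := by rintro ⟨rfl, rfl⟩; exact hxy hab.symm
  simp [arcFlow, h₁, h₂]

open Classical in
theorem sum_arcFlow [Fintype A] (a b x : A) :
    ∑ y, arcFlow 𝔽 a b x y = (if x = a then 1 else 0) - (if x = b then 1 else 0) := by
  simp [arcFlow, Finset.sum_sub_distrib, ite_and]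

open Classical in
/-- Between vertices joined by a walk that avoids `v` there is a unit flow that avoids `v`. -/
theorem exists_flow_avoiding [Fintype A] {v : A} {x y : ({v}ᶜ : Set A)}
    (w : (G.induce ({v}ᶜ : Set A)).Walk x y) :
    ∃ f : A → A → 𝔽, (∀ a b, f a b = -f b a) ∧ (∀ a b, ¬ G.Adj a b → f a b = 0) ∧
      (∀ b, f v b = 0) ∧
      ∀ a, ∑ b, f a b = (if a = x then 1 else 0) - (if a = y then 1 else 0) := by
  induction w with
  | nil => exact ⟨0, by simp⟩
  | @cons x z y h w ih =>
    obtain ⟨f, hf₁, hf₂, hf₃, hf₄⟩ := ih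
    have hx : v ≠ (x : A) := fun e => x.2 e.symm
    have hz : v ≠ (z : A) := fun e => z.2 e.symm
    refine ⟨arcFlow 𝔽 (x : A) z + f, fun a b => ?_, fun a b hab => ?_, fun b => ?_, fun a => ?_⟩
    · simp only [Pi.add_apply]
      rw [arcFlow_antisymm, hf₁]; ring
    · simp [arcFlow_eq_zero 𝔽 (SimpleGraph.induce_adj.1 h) hab, hf₂ a b hab]
    · simp [hf₃, arcFlow, hx, hz]
    · simp [Finset.sum_add_distrib, sum_arcFlow, hf₄]

open Classical in
/-- Two edges at a vertex that is not a cut-vertex lie on a common unit circulation. -/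
theorem exists_mem_cycleSpace [Fintype A] {v x y : A} (hv : ¬ IsCutVertex G v)
    (hx : G.Adj v x) (hy : G.Adj v y) :
    ∃ f ∈ cycleSpace 𝔽 G, ∀ b, f v b = (if b = x then 1 else 0) - (if b = y then 1 else 0) := by
  obtain ⟨w⟩ := not_not.1 hv ⟨x, hx.ne'⟩ ⟨y, hy.ne'⟩
  obtain ⟨f, hf₁, hf₂, hf₃, hf₄⟩ := exists_flow_avoiding 𝔽 w
  -- Leave `v` towards `x`, reach `y` while avoiding `v`, and return: at `v` only the first and last
  -- arcs carry flow.
  refine ⟨arcFlow 𝔽 v x + f + arcFlow 𝔽 y v,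
    ⟨fun a b => ?_, fun a b hab => ?_, fun a => ?_⟩, fun b => ?_⟩
  · simp only [Pi.add_apply]
    rw [arcFlow_antisymm, hf₁, arcFlow_antisymm 𝔽 y]; ring
  · simp [arcFlow_eq_zero 𝔽 hx hab, arcFlow_eq_zero 𝔽 hy.symm hab, hf₂ a b hab]
  · simp [Finset.sum_add_distrib, sum_arcFlow, hf₄]
  · simp [arcFlow, hf₃, hx.ne, hy.ne, sub_eq_add_neg]

open Classical in
/-- Restriction of an edge function to the arcs on which `c` takes the value `k`. -/
noncomputable def restrictToLevel {R : Type*} (c : A → A → R) (k : R) :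
    (A → A → 𝔽) →ₗ[𝔽] (A → A → 𝔽) where
  toFun f a b := if c a b = k then f a b else 0
  map_add' f g := by ext a b; simp only [Pi.add_apply]; split_ifs <;> simp
  map_smul' r f := by ext a b; simp

variable {𝔽}

/-- Restriction keeps a basis cycle whole if its level is `k` and erases it otherwise; linearity
extends this to the span. -/
theorem restrictToLevel_mem_cycleSpace [Fintype A] {R : Type*} {c : A → A → R}
    (hc : ∀ a b, c a b = c b a) {𝒞 : Finset (Cycle G)} (h𝒞 : IsCycleBasis 𝔽 G 𝒞)
    (hconst : ∀ C ∈ 𝒞, ∀ a b a' b', C.HasArc a b → C.HasArc a' b' → c a b = c a' b') (k : R)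
    {f : A → A → 𝔽} (hf : f ∈ cycleSpace 𝔽 G) : restrictToLevel 𝔽 c k f ∈ cycleSpace 𝔽 G := by
  classical
  rw [← h𝒞.2] at hf
  suffices h : Submodule.span 𝔽 (Cycle.vector 𝔽 '' (𝒞 : Set (Cycle G))) ≤
      (cycleSpace 𝔽 G).comap (restrictToLevel 𝔽 c k) from h hf
  rw [Submodule.span_le]
  rintro _ ⟨C, hC, rfl⟩
  have hmem : Cycle.vector 𝔽 C ∈ cycleSpace 𝔽 G :=
    h𝒞.2 ▸ Submodule.subset_span ⟨C, hC, rfl⟩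
  have hvec : ∀ a b, Cycle.vector 𝔽 C a b ≠ 0 → C.HasArc a b ∨ C.HasArc b a := by
    intro a b h
    by_contra! hn
    simp [Cycle.vector, hn] at h
  change restrictToLevel 𝔽 c k _ ∈ cycleSpace 𝔽 G
  by_cases hk : ∃ a b, C.HasArc a b ∧ c a b = k
  · obtain ⟨a, b, hab, rfl⟩ := hk
    convert hmem using 1
    ext a' b'
    change (if _ then _ else _) = _
    split_ifs with h
    · rfl
    · by_contra hne
      rcases hvec a' b' (Ne.symm hne) with h' | h'
      · exact h (hconst C hC _ _ _ _ h' hab)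
      · exact h ((hc _ _).trans (hconst C hC _ _ _ _ h' hab))
  · convert (cycleSpace 𝔽 G).zero_mem using 1
    ext a' b'
    change (if _ then _ else _) = _
    split_ifs with h
    · by_contra hne
      rcases hvec a' b' hne with h' | h'
      · exact hk ⟨_, _, h', h⟩
      · exact hk ⟨_, _, h', (hc _ _).trans h⟩
    · rfl

/-- In a one-block graph, an edge function that is constant along each cycle of a cycle basis is
constant. -/
theorem OneBlock.exists_eq_of_adj [Fintype A] {R : Type*} [Inhabited R] (hG : OneBlock G)
    {c : A → A → R} (hc : ∀ a b, c a b = c b a) {𝒞 : Finset (Cycle G)} (h𝒞 : IsCycleBasis 𝔽 G 𝒞)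
    (hconst : ∀ C ∈ 𝒞, ∀ a b a' b', C.HasArc a b → C.HasArc a' b' → c a b = c a' b') :
    ∃ k, ∀ a b, G.Adj a b → c a b = k := by
  classical
  have hloc : ∀ v x y, G.Adj v x → G.Adj v y → c v x = c v y := by
    intro v x y hx hy
    by_contra hne
    -- Restricted to the level of the edge to `x`, this circulation loses its flow to `y` and has
    -- net flow 1 at `v`, which is impossible.
    obtain ⟨f, hf, hfv⟩ := exists_mem_cycleSpace 𝔽 (hG.2 v) hx hy
    have h := (restrictToLevel_mem_cycleSpace hc h𝒞 hconst (c v x) hf).2.2 v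
    have : ∀ b, restrictToLevel 𝔽 c (c v x) f v b = if b = x then 1 else 0 := by
      intro b
      change (if _ then _ else _) = _
      rw [hfv]
      by_cases hbx : b = x
      · subst hbx
        have : b ≠ y := by rintro rfl; exact hne rfl
        simp [this]
      · by_cases hby : b = y
        · subst hby; simp [hbx, Ne.symm hne]
        · simp [hbx, hby]
    simp [this] at h
  have hwalk : ∀ v v' x x', G.Walk v v' → G.Adj v x → G.Adj v' x' → c v x = c v' x' := by
    intro v v' x x' w
    induction w generalizing x with
    | nil => exact hloc _ _ _
    | cons h w ih =>
      intro hx hx'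
      rw [hloc _ _ _ hx h, hc]
      exact ih _ h.symm hx'
  by_cases hE : ∃ a b, G.Adj a b
  · obtain ⟨a, b, hab⟩ := hE
    exact ⟨c a b, fun a' b' h => hwalk _ _ _ _ (hG.1.preconnected a' a).some h hab⟩
  · exact ⟨default, fun a b h => (hE ⟨a, b, h⟩).elim⟩

end Graph

/-! ### Relations along a cycle -/

/-- By rank-nullity the space of linear relations is a line, and it contains the all-ones relation.
-/
theorem eq_of_finrank_span_range_eq {E : Type*} [AddCommGroup E] [Module ℝ E] {n : ℕ}
    {v : Fin n → E} (hrank : Set.finrank ℝ (Set.range v) = n - 1) (hsum : ∑ i, v i = 0)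
    {c : Fin n → ℝ} (hc : ∑ i, c i • v i = 0) (i j : Fin n) : c i = c j := by
  have hn : 0 < n := i.pos
  set L := Fintype.linearCombination ℝ v
  have h₁ := L.finrank_range_add_finrank_ker
  rw [Fintype.range_linearCombination] at h₁
  change Set.finrank ℝ (Set.range v) + _ = _ at h₁
  rw [hrank, Module.finrank_fin_fun] at h₁
  have h₂ : Module.finrank ℝ (LinearMap.ker L) = 1 := by omega
  let one : LinearMap.ker L := ⟨fun _ => 1, by
    simpa [L, Fintype.linearCombination_apply] using hsum⟩
  have hone : one ≠ 0 := fun h => by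
    have := congrFun (congrArg Subtype.val h) i
    simp [one] at this
  obtain ⟨r, hr⟩ := (finrank_eq_one_iff_of_nonzero' one hone).1 h₂
    ⟨c, by simpa [L, Fintype.linearCombination_apply] using hc⟩
  have h := congrArg Subtype.val hr
  have hi := congrFun h i
  have hj := congrFun h j
  simp [one] at hi hj
  rw [← hi, ← hj]

theorem sum_darts_sub {A E : Type*} [AddCommGroup E] {G : SimpleGraph A} (y : A → E) {a b : A}
    (w : G.Walk a b) : (w.darts.map fun e => y e.snd - y e.fst).sum = y b - y a := by
  induction w with
  | nil => simp
  | cons h w ih => simp [ih]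

/-- If the differences of `v` along a cycle `C` have rank `|C| - 1` and the differences of `y` are
multiples of those of `v`, then the multiple is the same for all arcs of `C`. -/
theorem Cycle.coeff_eq {A E : Type*} [AddCommGroup E] [Module ℝ E] {G : SimpleGraph A}
    (C : Cycle G) {v y : A → E} {c : A → A → ℝ}
    (hrank : Set.finrank ℝ {x : E | ∃ a b, C.HasArc a b ∧ x = v b - v a} = C.length - 1)
    (hy : ∀ a b, G.Adj a b → y b - y a = c a b • (v b - v a)) {a b a' b' : A}
    (h : C.HasArc a b) (h' : C.HasArc a' b') : c a b = c a' b' := by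
  obtain ⟨e, he, rfl, rfl⟩ := h
  obtain ⟨e', he', rfl, rfl⟩ := h'
  obtain ⟨i, rfl⟩ := List.mem_iff_get.1 he
  obtain ⟨j, rfl⟩ := List.mem_iff_get.1 he'
  let D := C.walk.darts
  have hrange : {x : E | ∃ a b, C.HasArc a b ∧ x = v b - v a} =
      Set.range fun i : Fin D.length => v (D.get i).snd - v (D.get i).fst := by
    ext x
    constructor
    · rintro ⟨_, _, ⟨e, he, rfl, rfl⟩, rfl⟩
      obtain ⟨i, rfl⟩ := List.mem_iff_get.1 he
      exact ⟨i, rfl⟩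
    · rintro ⟨i, rfl⟩
      exact ⟨_, _, ⟨_, List.get_mem D i, rfl, rfl⟩, rfl⟩
  have hlen : C.length = D.length := C.walk.length_darts.symm
  rw [hrange, hlen] at hrank
  have hsum : ∀ z : A → E, ∑ i : Fin D.length, (z (D.get i).snd - z (D.get i).fst) = 0 := by
    intro z
    have := sum_darts_sub z C.walk
    rw [sub_self, ← Fin.sum_univ_getElem] at this
    rw [← this]
    exact Fintype.sum_equiv (finCongr (by simp [D])) _ _ (by simp [D])
  have hrel : ∑ i : Fin D.length, c (D.get i).fst (D.get i).snd •
      (v (D.get i).snd - v (D.get i).fst) = 0 := by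
    rw [← hsum y]
    exact Finset.sum_congr rfl fun i _ => (hy _ _ (D.get i).adj).symm
  exact eq_of_finrank_span_range_eq (c := fun i => c (D.get i).fst (D.get i).snd) hrank
    (hsum v) hrel i j

/-! ### Joint alignment is sufficient -/

section Sufficiency

variable {A Θ : Type*} [Fintype Θ] {m : ℕ}

theorem expect_mul_left (p v : Θ → ℝ) (c : ℝ) : expect p (fun θ => c * v θ) = c * expect p v := by
  simp only [expect, Finset.mul_sum]
  exact Finset.sum_congr rfl fun _ _ => by ring

theorem expect_add (p v w : Θ → ℝ) : expect p (fun θ => v θ + w θ) = expect p v + expect p w := by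
  simp only [expect, mul_add, Finset.sum_add_distrib]

theorem expect_sum {ι : Type*} (s : Finset ι) (p : Θ → ℝ) (v : ι → Θ → ℝ) :
    expect p (fun θ => ∑ i ∈ s, v i θ) = ∑ i ∈ s, expect p (v i) := by
  simp only [expect, Finset.mul_sum]
  exact Finset.sum_comm

theorem expect_const {p : Θ → ℝ} (hp : p ∈ stdSimplex ℝ Θ) (c : ℝ) :
    expect p (fun _ => c) = c := by
  simp only [expect, ← Finset.sum_mul, hp.2, one_mul]

theorem expect_mono {p : Θ → ℝ} (hp : p ∈ stdSimplex ℝ Θ) {v w : Θ → ℝ} (h : ∀ θ, v θ ≤ w θ) :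
    expect p v ≤ expect p w :=
  Finset.sum_le_sum fun θ _ => mul_le_mul_of_nonneg_left (h θ) (hp.1 θ)

theorem abs_expect_le {p : Θ → ℝ} (hp : p ∈ stdSimplex ℝ Θ) {v : Θ → ℝ} {B : ℝ}
    (h : ∀ θ, |v θ| ≤ B) : |expect p v| ≤ B := by
  rw [abs_le]
  constructor
  · rw [← expect_const hp (-B)]
    exact expect_mono hp fun θ => (abs_le.1 (h θ)).1
  · rw [← expect_const hp B]
    exact expect_mono hp fun θ => (abs_le.1 (h θ)).2

/-- Incentivizability is preserved by relabelling the reports through invertible affine maps. -/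
theorem Incentivizable.affine {u : A → Θ → ℝ} {Z : A → Matrix (Fin m) Θ ℝ}
    (hZ : Incentivizable u Z) {Γ : A → Matrix (Fin m) (Fin m) ℝ} (hΓ : ∀ a, IsUnit (Γ a))
    (κ : A → Fin m → ℝ) :
    Incentivizable u fun a => Γ a * Z a + Matrix.vecMulVec (κ a) (fun _ => 1) := by
  obtain ⟨V, hV⟩ := hZ
  have hdet : ∀ a, IsUnit (Γ a).det := fun a => (Matrix.isUnit_iff_isUnit_det _).1 (hΓ a)
  -- Decode the report and apply the old method; decoding is a bijection at each action.
  refine ⟨fun r a θ => V ((Γ a)⁻¹.mulVec (r - κ a)) a θ, fun p hp => ?_⟩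
  have hrep : ∀ a, (fun j => expect p
      ((Γ a * Z a + Matrix.vecMulVec (κ a) (fun _ => 1) : Matrix (Fin m) Θ ℝ) j)) =
      (Γ a).mulVec (fun j => expect p (Z a j)) + κ a := by
    intro a
    ext j
    have h₁ : (Γ a * Z a + Matrix.vecMulVec (κ a) (fun _ => 1) : Matrix (Fin m) Θ ℝ) j =
        fun θ => (∑ i, Γ a j i * Z a i θ) + κ a j := by
      ext θ; simp [Matrix.mul_apply, Matrix.vecMulVec_apply]
    rw [h₁, expect_add, expect_sum, expect_const hp]
    simp [Matrix.mulVec, dotProduct, expect_mul_left]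
  have hiff : ∀ (a : A) (r z : Fin m → ℝ),
      (Γ a)⁻¹.mulVec (r - κ a) = z ↔ r = (Γ a).mulVec z + κ a := by
    intro a r z
    rw [← sub_eq_iff_eq_add]
    constructor
    · rintro rfl
      simp [Matrix.mulVec_mulVec, Matrix.mul_nonsing_inv _ (hdet a)]
    · intro h
      simp [h, Matrix.mulVec_mulVec, Matrix.nonsing_inv_mul _ (hdet a)]
  ext ⟨r, a⟩
  have h := Set.ext_iff.1 (hV p hp) ((Γ a)⁻¹.mulVec (r - κ a), a)
  simp only [Set.mem_ofPred_eq, hiff] at h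
  simp only [Set.mem_ofPred_eq, hrep]
  refine Iff.trans ?_ h
  constructor
  · rintro hr ⟨s, b⟩
    have := hr ((Γ b).mulVec s + κ b, b)
    simpa only [(hiff b _ s).2 rfl] using this
  · rintro hr ⟨s, b⟩
    exact hr (_, b)

/-- A bounded expected score, maximized at the truthful reports of the optimal actions among the
reports in a bounded box, incentivizes. -/
theorem Incentivizable.of_score {u : A → Θ → ℝ} {Z : A → Matrix (Fin m) Θ ℝ}
    (S : (Fin m → ℝ) → A → Θ → ℝ) {B M : ℝ}
    (hZ : ∀ a j θ, |Z a j θ| ≤ B)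
    (hS : ∀ s a θ, (∀ j, |s j| ≤ B) → |S s a θ| ≤ M)
    (htruth : ∀ p ∈ stdSimplex ℝ Θ, ∀ s a, s ≠ (fun j => expect p (Z a j)) →
      expect p (S s a) < expect p (S (fun j => expect p (Z a j)) a))
    (hopt : ∀ p ∈ stdSimplex ℝ Θ, ∀ a b, expect p (u a) ≤ expect p (u b) ↔
      expect p (S (fun j => expect p (Z a j)) a) ≤ expect p (S (fun j => expect p (Z b j)) b)) :
    Incentivizable u Z := by
  classical
  -- The shift strictly exceeds `M`, so every report in the box earns more than the 0 paid outside
  -- it.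
  let N := |M| + 1
  have hN : 0 < N := by positivity
  have hMN : M < N := lt_of_le_of_lt (le_abs_self M) (lt_add_one _)
  have hmem : ∀ s a θ, (if ∀ j, |s j| ≤ B then (S s a θ + N) / (2 * N) else 0) ∈
      Set.Icc (0 : ℝ) 1 := by
    intro s a θ
    split_ifs with h
    · have := abs_le.1 (hS s a θ h)
      rw [Set.mem_Icc, div_le_one (by positivity)]
      exact ⟨div_nonneg (by linarith) (by positivity), by linarith⟩
    · simp
  refine ⟨fun s a θ => ⟨_, hmem s a θ⟩, fun p hp => ?_⟩
  set z : A → Fin m → ℝ := fun a j => expect p (Z a j)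
  have hz : ∀ a j, |z a j| ≤ B := fun a j => abs_expect_le hp (hZ a j)
  have hbox : ∀ s a, (∀ j, |s j| ≤ B) → expect p (fun θ =>
      if ∀ j, |s j| ≤ B then (S s a θ + N) / (2 * N) else 0) =
        (expect p (S s a) + N) / (2 * N) := by
    intro s a h
    simp only [h, implies_true, if_true]
    have : (fun θ => (S s a θ + N) / (2 * N)) = fun θ => (2 * N)⁻¹ * (S s a θ + N) := by
      ext θ; ring
    rw [this, expect_mul_left, expect_add, expect_const hp]
    ring
  have hout : ∀ s a, (¬ ∀ j, |s j| ≤ B) → expect p (fun θ =>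
      if ∀ j, |s j| ≤ B then (S s a θ + N) / (2 * N) else 0) = 0 := by
    intro s a h
    simp only [h, if_false]
    exact expect_const hp 0
  have hpos : ∀ a, 0 < (expect p (S (z a) a) + N) / (2 * N) := by
    intro a
    have := abs_le.1 (abs_expect_le hp fun θ => hS (z a) a θ (hz a))
    exact div_pos (by linarith) (by positivity)
  have hle : ∀ x y, (x + N) / (2 * N) ≤ (y + N) / (2 * N) ↔ x ≤ y := by
    intro x y
    rw [div_le_div_iff_of_pos_right (by positivity)]
    exact add_le_add_iff_right N
  ext ⟨s, a⟩
  simp only [argmax, Set.mem_ofPred_eq, optimalActions]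
  constructor
  · intro h
    have hs : ∀ j, |s j| ≤ B := by
      by_contra hs
      have := h (z a, a)
      rw [hbox _ _ (hz a), hout _ _ hs] at this
      exact absurd this (not_le.2 (hpos a))
    have hsz : s = z a := by
      by_contra hne
      have := h (z a, a)
      rw [hbox _ _ (hz a), hbox _ _ hs, hle] at this
      exact absurd this (not_le.2 (htruth p hp s a hne))
    refine ⟨fun b => (hopt p hp b a).2 ?_, hsz⟩
    have := h (z b, b)
    rwa [hbox _ _ (hz b), hbox _ _ hs, hle, hsz] at this
  · rintro ⟨ha, rfl⟩ ⟨s, b⟩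
    rw [hbox _ _ (hz a)]
    by_cases hs : ∀ j, |s j| ≤ B
    · rw [hbox _ _ hs, hle]
      refine le_trans ?_ ((hopt p hp b a).1 (ha b))
      by_cases hsb : s = z b
      · rw [hsb]
      · exact (htruth p hp s b hsb).le
    · rw [hout _ _ hs]
      exact (hpos a).le

/-- The quadratic score elicits the truth within each action; the term `K u` restores the ranking of
actions. -/
theorem incentivizable_vecMulVec_add [Fintype A] (u : A → Θ → ℝ) (lam : Fin m → ℝ)
    (d : Matrix (Fin m) Θ ℝ) : Incentivizable u fun a => Matrix.vecMulVec lam (u a) + d := by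
  set Z : A → Matrix (Fin m) Θ ℝ := fun a => Matrix.vecMulVec lam (u a) + d
  obtain ⟨B, hB⟩ := (Set.finite_range fun x : A × Fin m × Θ => |Z x.1 x.2.1 x.2.2|).bddAbove
  obtain ⟨U, hU⟩ := (Set.finite_range fun x : A × Θ => |u x.1 x.2|).bddAbove
  replace hB : ∀ a j θ, |Z a j θ| ≤ B := fun a j θ => hB ⟨(a, j, θ), rfl⟩
  replace hU : ∀ a θ, |u a θ| ≤ U := fun a θ => hU ⟨(a, θ), rfl⟩
  -- The sum bounds the slope of the squares in `E u`; the extra 1 leaves slope at least 1.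
  set K : ℝ := 1 + 2 * B * ∑ j, |lam j|
  let S : (Fin m → ℝ) → A → Θ → ℝ := fun s a θ =>
    (∑ j, (2 * s j * Z a j θ + -(s j) ^ 2)) + K * u a θ
  have hval : ∀ p ∈ stdSimplex ℝ Θ, ∀ s a, expect p (S s a) =
      (∑ j, (expect p (Z a j) ^ 2 - (s j - expect p (Z a j)) ^ 2)) + K * expect p (u a) := by
    intro p hp s a
    simp only [S, expect_add, expect_sum, expect_mul_left]
    congr 1
    refine Finset.sum_congr rfl fun j _ => ?_
    rw [expect_const hp]
    ring
  refine Incentivizable.of_score S (B := B) (M := (∑ _j : Fin m, 3 * B ^ 2) + |K| * U)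
    hB ?_ ?_ ?_
  · intro s a θ hs
    refine (abs_add_le _ _).trans (add_le_add ((Finset.abs_sum_le_sum_abs _ _).trans
      (Finset.sum_le_sum fun j _ => ?_)) ?_)
    · have h₀ := (abs_nonneg _).trans (hs j)
      have h₁ : |s j| * |Z a j θ| ≤ B * B := mul_le_mul (hs j) (hB a j θ) (abs_nonneg _) h₀
      have h₂ : |s j| ^ 2 ≤ B ^ 2 := pow_le_pow_left₀ (abs_nonneg _) (hs j) 2
      refine (abs_add_le _ _).trans ?_
      rw [abs_neg, abs_pow, abs_mul, abs_mul, abs_two]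
      linarith
    · rw [abs_mul]
      exact mul_le_mul_of_nonneg_left (hU a θ) (abs_nonneg K)
  · intro p hp s a hs
    rw [hval p hp, hval p hp]
    obtain ⟨i, hi⟩ := Function.ne_iff.1 hs
    refine add_lt_add_left (Finset.sum_lt_sum (fun j _ => ?_) ⟨i, Finset.mem_univ i, ?_⟩) _
    · rw [sub_self]; nlinarith [sq_nonneg (s j - expect p (Z a j))]
    · have := sq_pos_of_ne_zero (sub_ne_zero.2 hi)
      rw [sub_self]; linarith
  · intro p hp
    have key : ∀ a b, expect p (u a) ≤ expect p (u b) →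
        expect p (u b) - expect p (u a) ≤ expect p (S (fun j => expect p (Z b j)) b) -
          expect p (S (fun j => expect p (Z a j)) a) := by
      intro a b hab
      have hZj : ∀ a j, expect p (Z a j) = lam j * expect p (u a) + expect p (d j) := by
        intro a j
        rw [← expect_mul_left, ← expect_add]
        rfl
      have hj : ∀ j, -(2 * B * |lam j| * (expect p (u b) - expect p (u a))) ≤
          expect p (Z b j) ^ 2 - expect p (Z a j) ^ 2 := by
        intro j
        have ha := abs_expect_le hp (hB a j)
        have hb := abs_expect_le hp (hB b j)
        have h₁ : expect p (Z b j) ^ 2 - expect p (Z a j) ^ 2 =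
            lam j * (expect p (Z b j) + expect p (Z a j)) * (expect p (u b) - expect p (u a)) := by
          rw [sq_sub_sq, hZj a, hZj b]; ring
        rw [h₁, ← neg_mul]
        refine mul_le_mul_of_nonneg_right ?_ (sub_nonneg.2 hab)
        refine (abs_le.1 ?_).1
        rw [abs_mul, mul_comm]
        refine mul_le_mul_of_nonneg_right ((abs_add_le _ _).trans (by linarith)) (abs_nonneg _)
      have hsum := Finset.sum_le_sum fun j (_ : j ∈ Finset.univ) => hj j
      rw [Finset.sum_neg_distrib, ← Finset.sum_mul, ← Finset.mul_sum,
        Finset.sum_sub_distrib] at hsum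
      rw [hval p hp, hval p hp]
      simp only [sub_self, ne_eq, OfNat.ofNat_ne_zero, not_false_eq_true, zero_pow, sub_zero]
      simp only [K]
      linarith
    intro a b
    constructor
    · intro h
      linarith [key a b h]
    · intro h
      by_contra! hlt
      linarith [key b a hlt.le]

theorem JointlyAligned.robustlyIncentivizable [Fintype A] {u : A → Θ → ℝ}
    {X : A → Matrix (Fin m) Θ ℝ} (h : JointlyAligned u X) : RobustlyIncentivizable u X := by
  obtain ⟨lam, d, Γ, κ, hΓ, hX⟩ := h
  refine ⟨Γ, hΓ, fun t => ?_⟩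
  convert (incentivizable_vecMulVec_add u lam (d + t)).affine hΓ κ using 2 with a
  rw [hX a, ← add_assoc, Matrix.mul_add _ _ t]
  abel

end Sufficiency

/-! ### Joint alignment is necessary -/

section Necessity

variable {A Θ : Type*} [Fintype A] [Fintype Θ] {m : ℕ}

theorem expect_add_left (p q v : Θ → ℝ) : expect (p + q) v = expect p v + expect q v := by
  simp only [expect, Pi.add_apply, add_mul, Finset.sum_add_distrib]

theorem expect_smul_left (c : ℝ) (p v : Θ → ℝ) : expect (c • p) v = c * expect p v := by
  simp only [expect, Pi.smul_apply, smul_eq_mul, Finset.mul_sum, mul_assoc]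

theorem expect_sub_right (p v w : Θ → ℝ) : expect p (v - w) = expect p v - expect p w := by
  simp only [expect, Pi.sub_apply, mul_sub, Finset.sum_sub_distrib]

theorem continuous_expect (v : Θ → ℝ) : Continuous fun p : Θ → ℝ => expect p v := by
  unfold expect; fun_prop

/-- A vector that is zero or takes both signs has zero expectation under some full-support
belief. -/
theorem exists_pos_expect_eq_zero [Nonempty Θ] {v : Θ → ℝ} (h₁ : (∀ θ, 0 ≤ v θ) → v = 0)
    (h₂ : (∀ θ, v θ ≤ 0) → v = 0) :
    ∃ q ∈ stdSimplex ℝ Θ, (∀ θ, 0 < q θ) ∧ expect q v = 0 := by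
  classical
  obtain ⟨w, hw, hwv⟩ : ∃ w : Θ → ℝ, (∀ θ, 0 < w θ) ∧ expect w v = 0 := by
    by_cases hv : v = 0
    · exact ⟨1, fun _ => one_pos, by simp [hv, expect]⟩
    obtain ⟨i, hi⟩ : ∃ i, v i < 0 := by by_contra! h; exact hv (h₁ h)
    obtain ⟨j, hj⟩ : ∃ j, 0 < v j := by by_contra! h; exact hv (h₂ h)
    have hs : ∀ k (c : ℝ), expect (1 + Pi.single k c) v = expect 1 v + c * v k := by
      intro k c
      rw [expect_add_left]
      simp [expect, Pi.single_apply]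
    have hw : ∀ k (c : ℝ), 0 ≤ c → ∀ θ, 0 < (1 + Pi.single k c : Θ → ℝ) θ := by
      intro k c hc θ
      have : (0 : Θ → ℝ) ≤ Pi.single k c := Pi.single_nonneg.2 hc
      exact add_pos_of_pos_of_nonneg one_pos (this θ)
    -- Start from equal weights and add mass at a state where `v` has the opposite sign.
    rcases le_total 0 (expect 1 v) with h | h
    · refine ⟨1 + Pi.single i (expect 1 v / -v i), hw _ _ (div_nonneg h (neg_nonneg.2 hi.le)), ?_⟩
      rw [hs, div_neg, neg_mul, div_mul_cancel₀ _ hi.ne, add_neg_cancel]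
    · refine ⟨1 + Pi.single j (-expect 1 v / v j), hw _ _ (div_nonneg (neg_nonneg.2 h) hj.le), ?_⟩
      rw [hs, div_mul_cancel₀ _ hj.ne', add_neg_cancel]
  have hpos : 0 < ∑ θ, w θ := Finset.sum_pos (fun θ _ => hw θ) Finset.univ_nonempty
  have hq : ∀ θ, 0 < ((∑ θ, w θ)⁻¹ • w) θ := fun θ => mul_pos (inv_pos.2 hpos) (hw θ)
  refine ⟨(∑ θ, w θ)⁻¹ • w, ⟨fun θ => (hq θ).le, ?_⟩, hq, ?_⟩
  · simp only [Pi.smul_apply, smul_eq_mul, ← Finset.mul_sum]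
    exact inv_mul_cancel₀ hpos.ne'
  · rw [expect_smul_left, hwv, mul_zero]

/-- Adjacent actions are both optimal near some full-support belief, in the hyperplane of beliefs
at which they are equally good. -/
theorem exists_fullSupport_of_adj {u : A → Θ → ℝ} (hdom : NoWeaklyDominatedAction u) {a b : A}
    (hab : (adjacencyGraph u).Adj a b) :
    ∃ p ∈ stdSimplex ℝ Θ, expect p (u a) = expect p (u b) ∧
      ∀ᶠ q in nhds p, (∀ θ, 0 < q θ) ∧
        (expect q (u a) = expect q (u b) → a ∈ optimalActions u q ∧ b ∈ optimalActions u q) := by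
  obtain ⟨-, p₀, hp₀, hopt⟩ := hab
  have : Nonempty Θ := by
    by_contra h
    rw [not_nonempty_iff] at h
    simpa using hp₀.2
  have ha : a ∈ optimalActions u p₀ := by rw [hopt]; simp
  have hb : b ∈ optimalActions u p₀ := by rw [hopt]; simp
  have hab₀ : expect p₀ (u a) = expect p₀ (u b) := le_antisymm (hb a) (ha b)
  -- All other actions being strictly worse is an open condition, so it survives mixing `p₀` with a
  -- little of a full-support tie.
  let N : Set (Θ → ℝ) := {q | ∀ c, c ≠ a → c ≠ b → expect q (u c) < expect q (u a)}
  have hNopen : IsOpen N := by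
    simp only [N, Set.ofPred_forall]
    exact isOpen_iInter_of_finite fun c => isOpen_iInter_of_finite fun _ =>
      isOpen_iInter_of_finite fun _ => isOpen_lt (continuous_expect _) (continuous_expect _)
  have hN₀ : p₀ ∈ N := by
    intro c hca hcb
    refine lt_of_le_of_ne (ha c) fun h => ?_
    have : c ∈ optimalActions u p₀ := fun e => (ha e).trans h.ge
    rw [hopt] at this
    rcases this with h | h
    exacts [hca h, hcb h]
  have hNopt : ∀ q ∈ N, expect q (u a) = expect q (u b) →
      a ∈ optimalActions u q ∧ b ∈ optimalActions u q := by
    intro q hq h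
    have ha : ∀ c, expect q (u c) ≤ expect q (u a) := by
      intro c
      by_cases hca : c = a
      · rw [hca]
      by_cases hcb : c = b
      · rw [hcb, h]
      exact (hq c hca hcb).le
    exact ⟨ha, fun c => (ha c).trans h.le⟩
  obtain ⟨q, hq, hqpos, hq₀⟩ := exists_pos_expect_eq_zero (v := u b - u a)
    (fun h => by rw [hdom a b fun θ => sub_nonneg.1 (h θ), sub_self])
    (fun h => by rw [hdom b a fun θ => sub_nonpos.1 (h θ), sub_self])
  have hlim : Filter.Tendsto (fun ε : ℝ => (1 - ε) • p₀ + ε • q) (nhdsWithin 0 (Set.Ioi 0))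
      (nhds p₀) := by
    have : Continuous fun ε : ℝ => (1 - ε) • p₀ + ε • q := by fun_prop
    simpa using (this.tendsto 0).mono_left nhdsWithin_le_nhds
  obtain ⟨ε, hεN, hε₀, hε₁⟩ := ((hlim.eventually (hNopen.mem_nhds hN₀)).and
    (Ioo_mem_nhdsGT (one_pos : (0 : ℝ) < 1))).exists
  have hpos : ∀ θ, 0 < ((1 - ε) • p₀ + ε • q) θ := fun θ =>
    add_pos_of_nonneg_of_pos (mul_nonneg (by linarith) (hp₀.1 θ)) (mul_pos hε₀ (hqpos θ))
  refine ⟨(1 - ε) • p₀ + ε • q, convex_stdSimplex ℝ Θ hp₀ hq (by linarith) hε₀.le (by ring),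
    ?_, ?_⟩
  · rw [expect_sub_right] at hq₀
    simp only [expect_add_left, expect_smul_left, hab₀]
    linear_combination -ε * hq₀
  · have hposopen : IsOpen {q : Θ → ℝ | ∀ θ, 0 < q θ} := by
      simp only [Set.ofPred_forall]
      exact isOpen_iInter_of_finite fun θ => isOpen_lt continuous_const (continuous_apply θ)
    filter_upwards [hNopen.mem_nhds hεN, hposopen.mem_nhds hpos] with r hr hr'
    exact ⟨hr', hNopt r hr⟩

/-- If an incentivizable profile has no question at `b`, then the questions at an action `a`
adjacent to `b` only concern the payoff difference of the two actions. -/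
theorem Incentivizable.expect_eq_zero {u : A → Θ → ℝ} (hdom : NoWeaklyDominatedAction u)
    {X : A → Matrix (Fin m) Θ ℝ} (hX : Incentivizable u X) {a b : A}
    (hab : (adjacencyGraph u).Adj a b) (hb : X b = 0) {h : Θ → ℝ} (hsum : ∑ θ, h θ = 0)
    (horth : expect h (u a) = expect h (u b)) (j : Fin m) : expect h (X a j) = 0 := by
  obtain ⟨V, hV⟩ := hX
  obtain ⟨p, hp, hpab, hnear⟩ := exists_fullSupport_of_adj hdom hab
  have hlim : ∀ σ : ℝ, Filter.Tendsto (fun ε : ℝ => p + (ε * σ) • h)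
      (nhdsWithin 0 (Set.Ioi 0)) (nhds p) := by
    intro σ
    have : Continuous fun ε : ℝ => p + (ε * σ) • h := by fun_prop
    simpa using (this.tendsto 0).mono_left nhdsWithin_le_nhds
  obtain ⟨ε, ⟨h₁, h₂⟩, hε⟩ := (((hlim 1).eventually hnear).and
    ((hlim (-1)).eventually hnear)).and self_mem_nhdsWithin |>.exists
  have hε₀ : (0 : ℝ) < ε := hε
  have htie : ∀ c : ℝ, expect (p + c • h) (u a) = expect (p + c • h) (u b) := by
    intro c
    rw [expect_add_left, expect_add_left, expect_smul_left, expect_smul_left, hpab, horth]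
  have hmem : ∀ c : ℝ, (∀ θ, 0 < (p + c • h) θ) → p + c • h ∈ stdSimplex ℝ Θ := by
    intro c hc
    refine ⟨fun θ => (hc θ).le, ?_⟩
    simp only [Pi.add_apply, Pi.smul_apply, smul_eq_mul, Finset.sum_add_distrib,
      ← Finset.mul_sum, hsum, hp.2]
    ring
  let va : Θ → ℝ := fun θ => V (fun j => expect p (X a j)) a θ
  let vb : Θ → ℝ := fun θ => V 0 b θ
  have hrb : ∀ q : Θ → ℝ, (0 : Fin m → ℝ) = fun j => expect q (X b j) := by
    intro q; ext j; simp [hb, expect]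
  -- The truthful report at `b` is 0 under every belief, so the single payoff `vb` attains the
  -- maximum wherever `b` is optimal.
  have hmax : ∀ q ∈ stdSimplex ℝ Θ, b ∈ optimalActions u q → ∀ r c,
      expect q (fun θ => (V r c θ : ℝ)) ≤ expect q vb := by
    intro q hq hbq r c
    have : ((0 : Fin m → ℝ), b) ∈ argmax (fun ra : (Fin m → ℝ) × A =>
        expect q (fun θ => (V ra.1 ra.2 θ : ℝ))) := by
      rw [hV q hq]; exact ⟨hbq, hrb q⟩
    exact this (r, c)
  have hp₀ := hnear.self_of_nhds.2 hpab
  have hva : expect p va = expect p vb := by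
    refine le_antisymm (hmax p hp hp₀.2 _ _) ?_
    have : ((fun j => expect p (X a j)), a) ∈ argmax (fun ra : (Fin m → ℝ) × A =>
        expect p (fun θ => (V ra.1 ra.2 θ : ℝ))) := by
      rw [hV p hp]; exact ⟨hp₀.1, rfl⟩
    exact this (0, b)
  have hp₁ := hmax _ (hmem _ h₁.1) (h₁.2 (htie _)).2 (fun j => expect p (X a j)) a
  have hp₂ := hmax _ (hmem _ h₂.1) (h₂.2 (htie _)).2 (fun j => expect p (X a j)) a
  change expect _ va ≤ _ at hp₁ hp₂
  simp only [expect_add_left, expect_smul_left, hva] at hp₁ hp₂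
  -- The inequalities at `p + εh` and `p - εh` bound the slope of `va - vb` along `h` from both
  -- sides.
  have heq : expect (p + (ε * 1) • h) va = expect (p + (ε * 1) • h) vb := by
    simp only [expect_add_left, expect_smul_left, hva]
    linarith
  -- The truth for `p` is still optimal at `p + εh`, hence is also the truth there.
  have hfin : ((fun j => expect p (X a j)), a) ∈ argmax (fun ra : (Fin m → ℝ) × A =>
      expect (p + (ε * 1) • h) (fun θ => (V ra.1 ra.2 θ : ℝ))) := by
    rintro ⟨r, c⟩
    exact (hmax _ (hmem _ h₁.1) (h₁.2 (htie _)).2 r c).trans heq.ge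
  rw [hV _ (hmem _ h₁.1)] at hfin
  have := congrFun hfin.2 j
  simp only [expect_add_left, expect_smul_left] at this
  have h₀ : ε * expect h (X a j) = 0 := by linarith
  exact (mul_eq_zero.1 h₀).resolve_left hε₀.ne'

/-! ### Centering and orthogonal projection -/

theorem center_apply (v : Θ → ℝ) (θ : Θ) :
    center v θ = v θ - (∑ θ', v θ') / Fintype.card Θ := rfl

theorem center_sub (v w : Θ → ℝ) : center (v - w) = center v - center w := by
  ext θ
  simp only [center_apply, Pi.sub_apply, Finset.sum_sub_distrib]
  ring

theorem sum_center (v : Θ → ℝ) : ∑ θ, center v θ = 0 := by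
  rcases isEmpty_or_nonempty Θ with h | h
  · simp
  · simp only [center_apply, Finset.sum_sub_distrib, Finset.sum_const, Finset.card_univ,
      nsmul_eq_mul]
    field_simp
    ring

theorem expect_center {h : Θ → ℝ} (hsum : ∑ θ, h θ = 0) (v : Θ → ℝ) :
    expect h (center v) = expect h v := by
  simp only [expect, center_apply, mul_sub, Finset.sum_sub_distrib, ← Finset.sum_mul, hsum,
    zero_mul, sub_zero]

/-- The coefficient of the orthogonal projection of `w` onto the line spanned by `v`. -/
noncomputable def projCoeff (v w : Θ → ℝ) : ℝ := expect v w / expect v v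

theorem expect_self_eq_zero {v : Θ → ℝ} (h : expect v v = 0) : v = 0 :=
  dotProduct_self_eq_zero.1 h

theorem expect_comm (v w : Θ → ℝ) : expect v w = expect w v :=
  dotProduct_comm v w

/-- Makes the multiple attached to an edge independent of its direction. -/
theorem projCoeff_neg_neg (v w : Θ → ℝ) : projCoeff (-v) (-w) = projCoeff v w := by
  simp [projCoeff, expect]

/-- A vector orthogonal to all zero-sum vectors orthogonal to `v` is, up to constants, a multiple
of `v`. -/
theorem center_eq_projCoeff_smul {v w : Θ → ℝ}
    (hw : ∀ h : Θ → ℝ, ∑ θ, h θ = 0 → expect h v = 0 → expect h w = 0) :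
    center w = projCoeff (center v) (center w) • center v := by
  set c := projCoeff (center v) (center w)
  set h := center w - c • center v
  have hsum : ∑ θ, h θ = 0 := by
    simp [h, Finset.sum_sub_distrib, ← Finset.mul_sum, sum_center]
  have hv : expect h (center v) = 0 := by
    rw [expect_comm, expect_sub_right, expect_comm _ (c • _), expect_smul_left]
    -- If `center v` vanishes, the value of `c` is irrelevant.
    by_cases h₀ : expect (center v) (center v) = 0
    · rw [h₀, expect_self_eq_zero h₀]; simp [expect]
    · simp only [c, projCoeff]; field_simp; ring
  have h₀ : expect h h = 0 := by
    have : expect h (center w - c • center v) = 0 := by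
      rw [expect_sub_right, expect_comm h (c • _), expect_smul_left, expect_comm _ h, hv,
        expect_center hsum, hw h hsum (by rwa [← expect_center hsum])]
      ring
    exact this
  exact sub_eq_zero.1 (expect_self_eq_zero h₀)

theorem RobustlyIncentivizable.jointlyAligned {𝔽 : Type*} [Field 𝔽] {u : A → Θ → ℝ}
    {X : A → Matrix (Fin m) Θ ℝ} (hdom : NoWeaklyDominatedAction u)
    (hblock : OneBlock (adjacencyGraph u)) (hindep : IndependenceAssumption 𝔽 u)
    (hX : RobustlyIncentivizable u X) : JointlyAligned u X := by
  obtain ⟨μ, hμ, hX⟩ := hX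
  obtain ⟨𝒞, ⟨h𝒞, -⟩, hrank⟩ := hindep
  have hdet : ∀ a, IsUnit (μ a).det := fun a => (Matrix.isUnit_iff_isUnit_det _).1 (hμ a)
  let Y : A → Matrix (Fin m) Θ ℝ := fun a => (μ a)⁻¹ * X a
  have hXY : ∀ a, X a = μ a * Y a := fun a => by
    simp only [Y]; rw [← Matrix.mul_assoc, Matrix.mul_nonsing_inv _ (hdet a), Matrix.one_mul]
  have hexp : ∀ (h : Θ → ℝ) (M : Matrix (Fin m) Θ ℝ),
      (fun j => expect h (M j)) = M.mulVec h := by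
    intro h M; ext j; exact dotProduct_comm _ _
  have horth : ∀ a b, (adjacencyGraph u).Adj a b → ∀ j, ∀ h : Θ → ℝ, ∑ θ, h θ = 0 →
      expect h (u b - u a) = 0 → expect h (Y b j - Y a j) = 0 := by
    intro a b hab j h hsum hh
    -- The perturbation `-Y a` erases the questions at `a`.
    have hZ : ∀ c, X c + μ c * -Y a = μ c * (Y c - Y a) := fun c => by
      rw [hXY c, ← Matrix.mul_add, sub_eq_add_neg]
    have key : (fun j => expect h ((X b + μ b * -Y a : Matrix (Fin m) Θ ℝ) j)) = 0 :=
      funext fun j => (hX (-Y a)).expect_eq_zero hdom hab.symm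
        (by simp only [hZ, sub_self, Matrix.mul_zero]) hsum
        (by rw [expect_sub_right] at hh; linarith) j
    rw [hexp, hZ, ← Matrix.mulVec_mulVec] at key
    have h₂ : (Y b - Y a).mulVec h = 0 := by
      have := congrArg (Matrix.mulVec (μ b)⁻¹) key
      rwa [Matrix.mulVec_mulVec, Matrix.nonsing_inv_mul _ (hdet b), Matrix.one_mulVec,
        Matrix.mulVec_zero] at this
    rw [← hexp] at h₂
    exact congrFun h₂ j
  have hconst : ∀ j, ∃ k : ℝ, ∀ a b, (adjacencyGraph u).Adj a b →
      center (Y b j) - center (Y a j) = k • (center (u b) - center (u a)) := by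
    intro j
    let c : A → A → ℝ := fun a b => projCoeff (center (u b - u a)) (center (Y b j - Y a j))
    have hc : ∀ a b, c a b = c b a := by
      intro a b
      simp only [c, center_sub]
      rw [← projCoeff_neg_neg, neg_sub, neg_sub]
    have hy : ∀ a b, (adjacencyGraph u).Adj a b →
        center (Y b j) - center (Y a j) = c a b • (center (u b) - center (u a)) := by
      intro a b hab
      rw [← center_sub, ← center_sub]
      exact center_eq_projCoeff_smul (horth a b hab j)
    obtain ⟨k, hk⟩ := hblock.exists_eq_of_adj hc h𝒞 fun C hC _ _ _ _ h h' =>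
      C.coeff_eq (v := fun a => center (u a)) (y := fun a => center (Y a j)) (hrank C hC) hy h h'
    exact ⟨k, fun a b hab => hk a b hab ▸ hy a b hab⟩
  choose lam hlam using hconst
  obtain ⟨a₀⟩ := hblock.1.nonempty
  -- This difference is unchanged across each edge, hence along walks to `a₀`; it becomes `d`.
  have hd : ∀ a j, center (Y a j) - lam j • center (u a) =
      center (Y a₀ j) - lam j • center (u a₀) := by
    intro a j
    obtain ⟨w⟩ := hblock.1.preconnected a a₀
    induction w with
    | nil => rfl
    | cons h w ih =>
      rw [← ih]
      have := hlam j _ _ h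
      rw [smul_sub] at this
      rw [sub_eq_sub_iff_add_eq_add] at this ⊢
      rw [← sub_eq_zero] at this ⊢
      rw [← neg_eq_zero, ← this]
      abel
  let avg : (Θ → ℝ) → ℝ := fun v => (∑ θ, v θ) / Fintype.card Θ
  have hY : ∀ a, Y a = (Matrix.vecMulVec lam (u a) + Matrix.of fun j θ =>
      center (Y a₀ j) θ - lam j * center (u a₀) θ) +
        Matrix.vecMulVec (fun j => avg (Y a j) - lam j * avg (u a)) (fun _ => 1) := by
    intro a
    ext j θ
    have := congrFun (hd a j) θ
    simp only [Pi.sub_apply, Pi.smul_apply, smul_eq_mul] at this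
    simp only [Matrix.add_apply, Matrix.vecMulVec_apply, Matrix.of_apply]
    rw [← this]
    simp only [center_apply, avg]
    ring
  -- Centering discarded only averages; these go into `κ`, multiplied by `μ a`.
  refine ⟨lam, Matrix.of fun j θ => center (Y a₀ j) θ - lam j * center (u a₀) θ, μ,
    fun a => (μ a).mulVec fun j => avg (Y a j) - lam j * avg (u a), hμ,
    fun a => ?_⟩
  rw [← Matrix.mul_vecMulVec, ← Matrix.mul_add, ← hY a]
  exact hXY a

end Necessity

end BeliefElicitation

theorem mainTheorem1 {A Θ : Type*} [Fintype A] [Fintype Θ] (𝔽 : Type*) [Field 𝔽] (m : ℕ)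
    (u : A → Θ → ℝ) (X : A → Matrix (Fin m) Θ ℝ)
    (hdom : BeliefElicitation.NoWeaklyDominatedAction u)
    (hblock : BeliefElicitation.OneBlock (BeliefElicitation.adjacencyGraph u))
    (hlength : BeliefElicitation.CycleLengthAssumption 𝔽 u m)
    (hindep : BeliefElicitation.IndependenceAssumption 𝔽 u) :
    BeliefElicitation.RobustlyIncentivizable u X ↔ BeliefElicitation.JointlyAligned u X :=
  ⟨fun h => h.jointlyAligned hdom hblock hindep, fun h => h.robustlyIncentivizable⟩
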